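/- For $n\ge 1$ let $q_n=(\frac1n,0)\in\mathbb{R}^2$, and let $X^n\subset X_1^n$ be the open squares with sides parallel to the axes, centered at $q_n$, of widths $\frac{1}{2n(n+1)}$ and $\frac{1}{n(n+1)}$ respectively. Let $X=\{|x|<1,\ |y|<1\}$, and let $\phi\in C^\infty(\overline X)$ vanish to infinite order on $\partial X$ and satisfy either $\phi>0$ throughout $X$ or $\phi<0$ throughout $X$. Let $\gamma_n>0$ with $\gamma_n\to 0$, and let $K\in C^\infty(\mathbb{R}^2)$ satisfy $K\equiv 0$ on $\mathbb{R}^2\setminus\bigcup_{n\ge1}X_1^n$ and $$K(q)=\gamma_n\,\phi\big(4n(n+1)(q-q_n)\big),\qquad q\in\overline{X}^n,\ n\ge 1$$ ($K$ is otherwise arbitrary in the regions $X_1^n\setminus \overline{X}^n$). Let $U\subset\mathbb{R}^2$ be an open set containing the origin, let $g=g_{ij}dx^idx^j$ be a Riemannian metric of class $C^2$ (for instance a smooth one) on $U$ with Gaussian curvature $K$, and let $z\in C^2(U)$ be a solution in $U$ of the Darboux equation $$\det(\nabla_{ij}z)=K\,|g|\,\big(1-|\nabla_g z|^2\big),\qquad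 |g|=\det(g_{ij}),\quad |\nabla_g z|^2=g^{ij}\partial_iz\,\partial_jz,$$ where $\nabla_{ij}z=\partial_{ij}z-\Gamma_{ij}^k\partial_kz$ are the second covariant derivatives with respect to $g$. Then there is an $N\ge 1$ such that for every $n\ge N$ the closed square $\overline{X}^n$ lies in $U$ and the following property fails: $\nabla_{22}z=0$ on both vertical sides of $\partial X^n$ and $\nabla_{11}z=0$ on both horizontal sides of $\partial X^n$. -/

import Mathlib

open scoped ContDiff Topology

noncomputable section

namespace Darboux

/-- Points of the coordinate plane; `p 0` is `x = x¹` and `p 1` is `y = x²`. -/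
abbrev Plane : Type := Fin 2 → ℝ

/-! ### Riemannian geometry in a coordinate domain of the plane -/

/-- The partial derivative `∂ᵢ f` at `p`. -/
def pd (i : Fin 2) (f : Plane → ℝ) (p : Plane) : ℝ :=
  fderiv ℝ f p (Pi.single i 1)

/-- `g = gᵢⱼ dxⁱ dxʲ` is a Riemannian metric of class `C²` on `U`. -/
structure IsRiemannianMetricOn (g : Plane → Matrix (Fin 2) (Fin 2) ℝ) (U : Set Plane) :
    Prop where
  contDiffOn : ∀ i j, ContDiffOn ℝ 2 (fun p => g p i j) U
  posDef : ∀ p ∈ U, (g p).PosDef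

/-- The Christoffel symbol `Γᵏᵢⱼ = ½ gᵏˡ (∂ᵢ gⱼₗ + ∂ⱼ gᵢₗ - ∂ₗ gᵢⱼ)`. -/
def christoffel (g : Plane → Matrix (Fin 2) (Fin 2) ℝ) (k i j : Fin 2) (p : Plane) : ℝ :=
  (1 / 2 : ℝ) * ∑ l, (g p)⁻¹ k l *
    (pd i (fun q => g q j l) p + pd j (fun q => g q i l) p - pd l (fun q => g q i j) p)

/-- The component `Rⁱⱼₖₗ` of the Riemann tensor, with `R(∂ₖ, ∂ₗ) ∂ⱼ = Rⁱⱼₖₗ ∂ᵢ`. -/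
def riemann (g : Plane → Matrix (Fin 2) (Fin 2) ℝ) (i j k l : Fin 2) (p : Plane) : ℝ :=
  pd k (christoffel g i l j) p - pd l (christoffel g i k j) p
    + ∑ m, (christoffel g i k m p * christoffel g m l j p
      - christoffel g i l m p * christoffel g m k j p)

/-- The Gaussian curvature `⟨R(∂₁, ∂₂) ∂₂, ∂₁⟩ / |g|`. -/
def gaussCurvature (g : Plane → Matrix (Fin 2) (Fin 2) ℝ) (p : Plane) : ℝ :=
  (∑ m, g p 0 m * riemann g m 1 0 1 p) / (g p).det

/-- The second covariant derivative `∇ᵢⱼ z = ∂ᵢ ∂ⱼ z - Γᵏᵢⱼ ∂ₖ z`. -/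
def hess (g : Plane → Matrix (Fin 2) (Fin 2) ℝ) (z : Plane → ℝ) (i j : Fin 2) (p : Plane) : ℝ :=
  pd i (pd j z) p - ∑ k, christoffel g k i j p * pd k z p

/-- The squared length `|∇_g z|² = gⁱʲ ∂ᵢ z ∂ⱼ z` of the gradient. -/
def gradSq (g : Plane → Matrix (Fin 2) (Fin 2) ℝ) (z : Plane → ℝ) (p : Plane) : ℝ :=
  ∑ i, ∑ j, (g p)⁻¹ i j * pd i z p * pd j z p

/-- `z` is a `C²` solution on `U` of the Darboux equation
`det ∇ᵢⱼ z = K |g| (1 - |∇_g z|²)`. -/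
structure IsDarbouxSolution (g : Plane → Matrix (Fin 2) (Fin 2) ℝ) (K : Plane → ℝ)
    (U : Set Plane) (z : Plane → ℝ) : Prop where
  contDiffOn : ContDiffOn ℝ 2 z U
  eqn : ∀ p ∈ U, (Matrix.of fun i j => hess g z i j p).det
    = K p * (g p).det * (1 - gradSq g z p)

/-! ### Squares -/

/-- The open axis-parallel square with center `c` and width `w`. -/
def openSquare (c : Plane) (w : ℝ) : Set Plane := {p | ∀ i, |p i - c i| < w / 2}

/-- The closed axis-parallel square with center `c` and width `w`. -/
def closedSquare (c : Plane) (w : ℝ) : Set Plane := {p | ∀ i, |p i - c i| ≤ w / 2}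

/-- The left and right sides of the square with center `c` and width `w`. -/
def verticalSides (c : Plane) (w : ℝ) : Set Plane :=
  {p | |p 0 - c 0| = w / 2 ∧ |p 1 - c 1| ≤ w / 2}

/-- The bottom and top sides of the square with center `c` and width `w`. -/
def horizontalSides (c : Plane) (w : ℝ) : Set Plane :=
  {p | |p 0 - c 0| ≤ w / 2 ∧ |p 1 - c 1| = w / 2}

/-! ### The curvature function; the indices `n` of the squares start at `1` -/

/-- The center `qₙ = (1/n, 0)`. -/
def center (n : ℕ) : Plane := ![1 / (n : ℝ), 0]

/-- The width `1 / (2n(n+1))` of the inner square `Xⁿ`. -/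
def innerWidth (n : ℕ) : ℝ := 1 / (2 * (n : ℝ) * ((n : ℝ) + 1))

/-- The width `1 / (n(n+1))` of the outer square `X₁ⁿ`. -/
def outerWidth (n : ℕ) : ℝ := 1 / ((n : ℝ) * ((n : ℝ) + 1))

/-- `φ` is smooth on the closed square `|x| ≤ 1, |y| ≤ 1`, vanishes to infinite order on its
boundary, and is either positive or negative throughout the open square. -/
structure IsProfile (φ : Plane → ℝ) : Prop where
  smooth : ContDiffOn ℝ ∞ φ (closedSquare 0 2)
  flat : ∀ p ∈ closedSquare 0 2 \ openSquare 0 2, ∀ k : ℕ,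
    iteratedFDerivWithin ℝ k φ (closedSquare 0 2) p = 0
  sign : (∀ p ∈ openSquare 0 2, 0 < φ p) ∨ (∀ p ∈ openSquare 0 2, φ p < 0)

/-- The class of functions `K` considered: smooth on the plane, zero off the outer squares, and
equal to the rescaled profile `γₙ φ(4n(n+1)(q - qₙ))` on the closed inner squares. Nothing but
smoothness is prescribed between the inner and the outer squares. -/
structure IsCurvatureFunction (K : Plane → ℝ) : Prop where
  smooth : ContDiff ℝ ∞ K
  eq_zero : ∀ p, (∀ n : ℕ, 1 ≤ n → p ∉ openSquare (center n) (outerWidth n)) → K p = 0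
  eq_profile : ∃ (φ : Plane → ℝ) (γ : ℕ → ℝ), IsProfile φ ∧ (∀ n, 1 ≤ n → 0 < γ n) ∧
    Filter.Tendsto γ Filter.atTop (𝓝 0) ∧
    ∀ n : ℕ, 1 ≤ n → ∀ q ∈ closedSquare (center n) (innerWidth n),
      K q = γ n * φ ((4 * (n : ℝ) * ((n : ℝ) + 1)) • (q - center n))

end Darboux

end

/-! The profile vanishes on `∂Xⁿ`, so `K = 0` there and the Darboux equation makes the Hessian
singular. If `∇₂₂z = 0` on a vertical side, the determinant reduces to `-(∇₁₂z)²`, so `∇₁₂z = 0` too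
and `∇z` is parallel along that side; horizontal sides are symmetric. If the property held, `∇z`
would be parallel around all of `∂Xⁿ`.

Parallel transport around this loop rotates by the total curvature `∫ K √|g|`, by Cartan's structure
equation `pd_connectionForm_sub` and Green's theorem `integral_pd_sub_pd`. The angle is nonzero
because `K` has a strict sign in `Xⁿ`, and smaller than `2π` for large `n` because the connection
form is bounded near the origin. Such a rotation fixes only the zero vector, so `∇z = 0` on `∂Xⁿ`
(`frameGradient_eq_zero_of_parallel`).

Inside, the derivative of `|∇z|²` is twice the Hessian applied to `∇z`, and the Hessian is
invertible where `K ≠ 0` and `|∇z| < 1`. Hence `|∇z|²` has no positive interior maximum, `∇z`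
vanishes throughout `Xⁿ`, and the Hessian is zero at the center, against `K ≠ 0`
(`IsDarbouxSolution.false_of_pd_eq_zero`). The bound `|∇z| < 1` follows from continuity at the
origin, since `|∇z|²` oscillates little on nearby squares and vanishes on `∂Xⁿ`. -/

namespace Darboux

open Set Function MeasureTheory

/-! ### Partial derivatives as derivatives along coordinate lines. -/

section Calculus

variable {U : Set Plane} {f : Plane → ℝ} {p : Plane}

theorem hasDerivAt_comp_update (hf : DifferentiableAt ℝ f p) (k : Fin 2) :
    HasDerivAt (fun t => f (update p k t)) (pd k f p) (p k) := by
  have h := hasDerivAt_update p k (p k)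
  have hf' : HasFDerivAt f (fderiv ℝ f p) (update p k (p k)) := by
    rw [update_eq_self]; exact hf.hasFDerivAt
  exact hf'.comp_hasDerivAt (p k) h

theorem pd_eq_of_hasDerivAt (hf : DifferentiableAt ℝ f p) {k : Fin 2} {d : ℝ}
    (h : HasDerivAt (fun t => f (update p k t)) d (p k)) : pd k f p = d :=
  (hasDerivAt_comp_update hf k).unique h

theorem contDiffOn_pd {n m : WithTop ℕ∞} (hU : IsOpen U) (hf : ContDiffOn ℝ n f U)
    (hm : m + 1 ≤ n) (k : Fin 2) : ContDiffOn ℝ m (pd k f) U :=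
  (hf.fderiv_of_isOpen hU hm).clm_apply contDiffOn_const

theorem differentiableAt_of_contDiffOn {n : WithTop ℕ∞} (hU : IsOpen U)
    (hf : ContDiffOn ℝ n f U) (hn : n ≠ 0) (hp : p ∈ U) : DifferentiableAt ℝ f p :=
  (hf.contDiffAt (hU.mem_nhds hp)).differentiableAt hn

theorem pd_congr {f' : Plane → ℝ} (hU : IsOpen U) (h : ∀ q ∈ U, f q = f' q) (hp : p ∈ U)
    (k : Fin 2) : pd k f p = pd k f' p := by
  have : f =ᶠ[𝓝 p] f' := Filter.eventuallyEq_of_mem (hU.mem_nhds hp) h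
  simp only [pd, this.fderiv_eq]

theorem pd_pd_comm (hU : IsOpen U) (hf : ContDiffOn ℝ 2 f U) (hp : p ∈ U) (i j : Fin 2) :
    pd i (pd j f) p = pd j (pd i f) p := by
  have hd : DifferentiableAt ℝ (fderiv ℝ f) p :=
    ((hf.fderiv_of_isOpen hU (m := 1) (by norm_num)).contDiffAt
      (hU.mem_nhds hp)).differentiableAt one_ne_zero
  have key : ∀ i j : Fin 2, pd i (pd j f) p
      = fderiv ℝ (fderiv ℝ f) p (Pi.single i 1) (Pi.single j 1) := by
    intro i j
    have h := hd.hasFDerivAt.clm_apply (hasFDerivAt_const (Pi.single j (1 : ℝ) : Plane) p)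
    have : fderiv ℝ (pd j f) p = _ := h.fderiv
    rw [pd, this]
    simp
  rw [key, key]
  exact ((hf.contDiffAt (hU.mem_nhds hp)).isSymmSndFDerivAt (by simp)) _ _

end Calculus

/-! ### Levi-Civita connection, connection form and Cartan's structure equation. -/

section Metric

variable {U : Set Plane} {g : Plane → Matrix (Fin 2) (Fin 2) ℝ} {p : Plane}

theorem IsRiemannianMetricOn.symm (hg : IsRiemannianMetricOn g U) (hp : p ∈ U) (i j : Fin 2) :
    g p i j = g p j i := by
  simpa using (hg.posDef p hp).isHermitian.apply j i

theorem IsRiemannianMetricOn.det_pos (hg : IsRiemannianMetricOn g U) (hp : p ∈ U) :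
    0 < g p 0 0 * g p 1 1 - g p 0 1 ^ 2 := by
  have h := (hg.posDef p hp).det_pos
  rw [Matrix.det_fin_two, hg.symm hp 1 0] at h
  linarith

theorem IsRiemannianMetricOn.diag_pos (hg : IsRiemannianMetricOn g U) (hp : p ∈ U) (i : Fin 2) :
    0 < g p i i :=
  (hg.posDef p hp).diag_pos

theorem IsRiemannianMetricOn.pd_symm (hU : IsOpen U) (hg : IsRiemannianMetricOn g U) (hp : p ∈ U)
    (k i j : Fin 2) : pd k (fun q => g q i j) p = pd k (fun q => g q j i) p :=
  pd_congr hU (fun _ hq => hg.symm hq i j) hp k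

theorem IsRiemannianMetricOn.inv_eq (hg : IsRiemannianMetricOn g U) (hp : p ∈ U) :
    (g p)⁻¹ = (g p 0 0 * g p 1 1 - g p 0 1 ^ 2)⁻¹ •
      !![g p 1 1, -g p 0 1; -g p 0 1, g p 0 0] := by
  rw [Matrix.inv_def, Matrix.det_fin_two, Matrix.adjugate_fin_two, hg.symm hp 1 0,
    Ring.inverse_eq_inv', sq]

theorem christoffel_symm (hU : IsOpen U) (hg : IsRiemannianMetricOn g U) (hp : p ∈ U)
    (k i j : Fin 2) : christoffel g k i j p = christoffel g k j i p := by
  simp only [christoffel, hg.pd_symm hU hp _ i j]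
  congr 1
  refine Finset.sum_congr rfl fun l _ => ?_
  ring

theorem christoffel_lower (hg : IsRiemannianMetricOn g U) (hp : p ∈ U)
    (m i j : Fin 2) : g p m 0 * christoffel g 0 i j p + g p m 1 * christoffel g 1 i j p
      = (pd i (fun q => g q j m) p + pd j (fun q => g q i m) p - pd m (fun q => g q i j) p) / 2 := by
  have hd := (hg.det_pos hp).ne'
  have hs := hg.symm hp 1 0
  simp only [christoffel, Fin.sum_univ_two, hg.inv_eq hp]
  fin_cases m <;> simp [hs] <;> field_simp <;> ring

/-- Metric compatibility of the Levi-Civita connection. -/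
theorem pd_metric (hU : IsOpen U) (hg : IsRiemannianMetricOn g U) (hp : p ∈ U) (k i j : Fin 2) :
    pd k (fun q => g q i j) p =
      (g p j 0 * christoffel g 0 k i p + g p j 1 * christoffel g 1 k i p)
      + (g p i 0 * christoffel g 0 k j p + g p i 1 * christoffel g 1 k j p) := by
  rw [christoffel_lower hg hp, christoffel_lower hg hp, hg.pd_symm hU hp k j i,
    hg.pd_symm hU hp i k j, hg.pd_symm hU hp j k i, hg.pd_symm hU hp i j k]
  ring

theorem contDiffOn_det (hg : IsRiemannianMetricOn g U) :
    ContDiffOn ℝ 2 (fun q => g q 0 0 * g q 1 1 - g q 0 1 ^ 2) U :=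
  ((hg.contDiffOn 0 0).mul (hg.contDiffOn 1 1)).sub ((hg.contDiffOn 0 1).pow 2)

theorem contDiffOn_inv (hg : IsRiemannianMetricOn g U) (k l : Fin 2) :
    ContDiffOn ℝ 2 (fun q => (g q)⁻¹ k l) U := by
  have h : ∀ q ∈ U, (g q)⁻¹ k l = (g q 0 0 * g q 1 1 - g q 0 1 ^ 2)⁻¹ *
      (!![g q 1 1, -g q 0 1; -g q 0 1, g q 0 0] : Matrix (Fin 2) (Fin 2) ℝ) k l := by
    intro q hq
    rw [hg.inv_eq hq]; rfl
  refine ContDiffOn.congr ?_ h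
  refine ((contDiffOn_det hg).inv fun q hq => (hg.det_pos hq).ne').mul ?_
  fin_cases k <;> fin_cases l <;> simp
  exacts [hg.contDiffOn 1 1, (hg.contDiffOn 0 1).neg, (hg.contDiffOn 0 1).neg, hg.contDiffOn 0 0]

theorem contDiffOn_christoffel (hU : IsOpen U) (hg : IsRiemannianMetricOn g U) (k i j : Fin 2) :
    ContDiffOn ℝ 1 (christoffel g k i j) U := by
  have hd : ∀ i j l, ContDiffOn ℝ 1 (pd i (fun q => g q j l)) U := fun i j l =>
    contDiffOn_pd hU (hg.contDiffOn j l) (by norm_num) i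
  unfold christoffel
  refine contDiffOn_const.mul (ContDiffOn.sum fun l _ => ?_)
  exact ((contDiffOn_inv hg k l).of_le (by norm_num)).mul
    (((hd i j l).add (hd j i l)).sub (hd l i j))

/-- The area density `√|g|`. -/
noncomputable def areaDensity (g : Plane → Matrix (Fin 2) (Fin 2) ℝ) (p : Plane) : ℝ :=
  √(g p 0 0 * g p 1 1 - g p 0 1 ^ 2)

theorem areaDensity_pos (hg : IsRiemannianMetricOn g U) (hp : p ∈ U) : 0 < areaDensity g p :=
  Real.sqrt_pos.2 (hg.det_pos hp)

theorem areaDensity_sq (hg : IsRiemannianMetricOn g U) (hp : p ∈ U) :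
    areaDensity g p ^ 2 = g p 0 0 * g p 1 1 - g p 0 1 ^ 2 :=
  Real.sq_sqrt (hg.det_pos hp).le

theorem contDiffOn_areaDensity (hg : IsRiemannianMetricOn g U) :
    ContDiffOn ℝ 2 (areaDensity g) U :=
  (contDiffOn_det hg).sqrt fun _ hq => (hg.det_pos hq).ne'

/-- Jacobi's formula for the derivative of a determinant, combined with metric compatibility. -/
theorem pd_areaDensity (hU : IsOpen U) (hg : IsRiemannianMetricOn g U) (hp : p ∈ U) (k : Fin 2) :
    pd k (areaDensity g) p
      = areaDensity g p * (christoffel g 0 k 0 p + christoffel g 1 k 1 p) := by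
  have hgd : ∀ i j, HasDerivAt (fun t => g (update p k t) i j) (pd k (fun q => g q i j) p) (p k) :=
    fun i j => hasDerivAt_comp_update
      (differentiableAt_of_contDiffOn hU (hg.contDiffOn i j) two_ne_zero hp) k
  have hW := areaDensity_pos hg hp
  have hW2 := areaDensity_sq hg hp
  refine pd_eq_of_hasDerivAt
    (differentiableAt_of_contDiffOn hU (contDiffOn_areaDensity hg) two_ne_zero hp) ?_
  have h := (((hgd 0 0).mul (hgd 1 1)).sub ((hgd 0 1).pow 2)).sqrt
    (by simpa using (hg.det_pos hp).ne')
  simp only [Pi.mul_apply, Pi.sub_apply, Pi.pow_apply, update_eq_self] at h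
  refine h.congr_deriv ?_
  change _ / (2 * areaDensity g p) = _
  rw [div_eq_iff (by positivity), pd_metric hU hg hp, pd_metric hU hg hp, pd_metric hU hg hp,
    hg.symm hp 1 0]
  norm_num
  linear_combination (-2 * (christoffel g 0 k 0 p + christoffel g 1 k 1 p)) * hW2

/-- The connection form of the orthonormal frame obtained from `∂₂, ∂₁` by Gram-Schmidt. -/
noncomputable def connectionForm (g : Plane → Matrix (Fin 2) (Fin 2) ℝ) (k : Fin 2) (p : Plane) :
    ℝ :=
  areaDensity g p * christoffel g 0 k 1 p / g p 1 1

theorem contDiffOn_connectionForm (hU : IsOpen U) (hg : IsRiemannianMetricOn g U) (k : Fin 2) :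
    ContDiffOn ℝ 1 (connectionForm g k) U :=
  (((contDiffOn_areaDensity hg).of_le (by norm_num)).mul (contDiffOn_christoffel hU hg 0 k 1)).div
    ((hg.contDiffOn 1 1).of_le (by norm_num)) fun _ hq => (hg.diag_pos hq 1).ne'

theorem pd_connectionForm (hU : IsOpen U) (hg : IsRiemannianMetricOn g U) (hp : p ∈ U)
    (l k : Fin 2) :
    pd l (connectionForm g k) p = ((pd l (areaDensity g) p * christoffel g 0 k 1 p
      + areaDensity g p * pd l (christoffel g 0 k 1) p) * g p 1 1
      - areaDensity g p * christoffel g 0 k 1 p * pd l (fun q => g q 1 1) p) / g p 1 1 ^ 2 := by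
  refine pd_eq_of_hasDerivAt
    (differentiableAt_of_contDiffOn hU (contDiffOn_connectionForm hU hg k) one_ne_zero hp) ?_
  have h1 := hasDerivAt_comp_update
    (differentiableAt_of_contDiffOn hU (contDiffOn_areaDensity hg) two_ne_zero hp) l
  have h2 := hasDerivAt_comp_update
    (differentiableAt_of_contDiffOn hU (contDiffOn_christoffel hU hg 0 k 1) one_ne_zero hp) l
  have h3 := hasDerivAt_comp_update
    (differentiableAt_of_contDiffOn hU (hg.contDiffOn 1 1) two_ne_zero hp) l
  have h := (h1.mul h2).div h3 (by simpa using (hg.diag_pos hp 1).ne')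
  simp only [Pi.mul_apply, update_eq_self] at h
  exact h

/-- This is `⟨R(∂₁, ∂₂)∂₂, ∂₂⟩ = 0`. It expresses that the mixed second derivatives of `g₂₂ = ⟨∂₂,
∂₂⟩` commute, once each is expanded by metric compatibility. -/
theorem riemann_antisymm (hU : IsOpen U) (hg : IsRiemannianMetricOn g U) (hp : p ∈ U) :
    g p 0 1 * riemann g 0 1 0 1 p + g p 1 1 * riemann g 1 1 0 1 p = 0 := by
  have hgd : ∀ i j k, HasDerivAt (fun t => g (update p k t) i j) (pd k (fun q => g q i j) p) (p k) :=
    fun i j k => hasDerivAt_comp_update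
      (differentiableAt_of_contDiffOn hU (hg.contDiffOn i j) two_ne_zero hp) k
  have hΓ : ∀ i j l k, HasDerivAt (fun t => christoffel g i j l (update p k t))
      (pd k (christoffel g i j l) p) (p k) := fun i j l k => hasDerivAt_comp_update
      (differentiableAt_of_contDiffOn hU (contDiffOn_christoffel hU hg i j l) one_ne_zero hp) k
  have key : ∀ l k, pd l (pd k (fun q => g q 1 1)) p =
      2 * (pd l (fun q => g q 0 1) p * christoffel g 0 k 1 p
        + g p 0 1 * pd l (christoffel g 0 k 1) p
        + (pd l (fun q => g q 1 1) p * christoffel g 1 k 1 p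
        + g p 1 1 * pd l (christoffel g 1 k 1) p)) := by
    intro l k
    have hE : ∀ q ∈ U, pd k (fun q => g q 1 1) q =
        2 * (g q 0 1 * christoffel g 0 k 1 q + g q 1 1 * christoffel g 1 k 1 q) := by
      intro q hq
      rw [pd_metric hU hg hq, hg.symm hq 1 0]
      ring
    rw [pd_congr hU hE hp l]
    refine pd_eq_of_hasDerivAt ?_ ?_
    · refine (((differentiableAt_of_contDiffOn hU (hg.contDiffOn 0 1) two_ne_zero hp).mul
        (differentiableAt_of_contDiffOn hU (contDiffOn_christoffel hU hg 0 k 1)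
          one_ne_zero hp)).add
        ((differentiableAt_of_contDiffOn hU (hg.contDiffOn 1 1) two_ne_zero hp).mul
        (differentiableAt_of_contDiffOn hU (contDiffOn_christoffel hU hg 1 k 1)
          one_ne_zero hp))).const_mul 2
    · have h := (((hgd 0 1 l).mul (hΓ 0 k 1 l)).add ((hgd 1 1 l).mul (hΓ 1 k 1 l))).const_mul 2
      simp only [update_eq_self] at h
      exact h
  have hc := pd_pd_comm hU (hg.contDiffOn 1 1) hp 0 1
  rw [key, key] at hc
  simp only [pd_metric hU hg hp, hg.symm hp 1 0, christoffel_symm hU hg hp _ 1 0] at hc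
  simp only [riemann, Fin.sum_univ_two, christoffel_symm hU hg hp _ 1 0]
  linear_combination hc / 2

/-- Cartan's structure equation: the exterior derivative of the connection form is the curvature. -/
theorem pd_connectionForm_sub (hU : IsOpen U) (hg : IsRiemannianMetricOn g U) (hp : p ∈ U) :
    pd 0 (connectionForm g 1) p - pd 1 (connectionForm g 0) p
      = gaussCurvature g p * areaDensity g p := by
  have hR := riemann_antisymm hU hg hp
  have hG := (hg.diag_pos hp 1).ne'
  have hD := (hg.det_pos hp).ne'
  -- By `riemann_antisymm` the component `R²₂₁₂` can be eliminated, and the determinant cancels.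
  have hK : gaussCurvature g p = riemann g 0 1 0 1 p / g p 1 1 := by
    rw [gaussCurvature, Matrix.det_fin_two, Fin.sum_univ_two, hg.symm hp 1 0, ← sq,
      div_eq_div_iff hD hG]
    linear_combination g p 0 1 * hR
  rw [hK, pd_connectionForm hU hg hp, pd_connectionForm hU hg hp, pd_areaDensity hU hg hp,
    pd_areaDensity hU hg hp, pd_metric hU hg hp, pd_metric hU hg hp]
  simp only [riemann, Fin.sum_univ_two, hg.symm hp 1 0, christoffel_symm hU hg hp _ 1 0]
  field_simp
  ring

end Metric

/-! ### The Hessian, the squared gradient and the gradient in a moving frame. -/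

section Gradient

variable {U : Set Plane} {g : Plane → Matrix (Fin 2) (Fin 2) ℝ} {z : Plane → ℝ} {p : Plane}

theorem pd_pd_eq_hess (i j : Fin 2) :
    pd i (pd j z) p = hess g z i j p
      + (christoffel g 0 i j p * pd 0 z p + christoffel g 1 i j p * pd 1 z p) := by
  simp [hess, Fin.sum_univ_two]

theorem hess_symm (hU : IsOpen U) (hg : IsRiemannianMetricOn g U) (hz : ContDiffOn ℝ 2 z U)
    (hp : p ∈ U) (i j : Fin 2) : hess g z i j p = hess g z j i p := by
  simp only [hess, pd_pd_comm hU hz hp i j, christoffel_symm hU hg hp _ i j]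

theorem det_hess (hU : IsOpen U) (hg : IsRiemannianMetricOn g U) (hz : ContDiffOn ℝ 2 z U)
    (hp : p ∈ U) : (Matrix.of fun i j => hess g z i j p).det
      = hess g z 0 0 p * hess g z 1 1 p - hess g z 0 1 p ^ 2 := by
  rw [Matrix.det_fin_two]
  simp only [Matrix.of_apply, hess_symm hU hg hz hp 1 0, sq]

theorem gradSq_eq (hg : IsRiemannianMetricOn g U) (hp : p ∈ U) :
    gradSq g z p = (g p 1 1 * pd 0 z p ^ 2 - 2 * g p 0 1 * pd 0 z p * pd 1 z p
      + g p 0 0 * pd 1 z p ^ 2) / (g p 0 0 * g p 1 1 - g p 0 1 ^ 2) := by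
  have hd := (hg.det_pos hp).ne'
  simp only [gradSq, Fin.sum_univ_two, hg.inv_eq hp]
  simp
  field_simp
  ring

theorem contDiffOn_gradSq (hU : IsOpen U) (hg : IsRiemannianMetricOn g U)
    (hz : ContDiffOn ℝ 2 z U) : ContDiffOn ℝ 1 (gradSq g z) U := by
  unfold gradSq
  refine ContDiffOn.sum fun i _ => ContDiffOn.sum fun j _ => ?_
  exact (((contDiffOn_inv hg i j).of_le (by norm_num)).mul
    (contDiffOn_pd hU hz (by norm_num) i)).mul (contDiffOn_pd hU hz (by norm_num) j)

theorem pd_eq_zero_of_gradSq_nonpos (hg : IsRiemannianMetricOn g U) (hp : p ∈ U)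
    (h : gradSq g z p ≤ 0) (i : Fin 2) : pd i z p = 0 := by
  have hd := hg.det_pos hp
  have hE := hg.diag_pos hp 0
  have hG := hg.diag_pos hp 1
  rw [gradSq_eq hg hp] at h
  replace h := not_lt.1 fun hn => h.not_gt (div_pos hn hd)
  have h1 : pd 1 z p ^ 2 ≤ 0 := by
    by_contra! h1
    -- Completing the square: `g₂₂` times the numerator is `(g₂₂ ∂₁z - g₁₂ ∂₂z)² + |g| (∂₂z)²`.
    nlinarith [mul_pos hd h1, sq_nonneg (g p 1 1 * pd 0 z p - g p 0 1 * pd 1 z p),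
      mul_nonpos_of_nonneg_of_nonpos hG.le h]
  have h1 : pd 1 z p = 0 := pow_eq_zero_iff two_ne_zero |>.1 (le_antisymm h1 (sq_nonneg _))
  have h0 : pd 0 z p ^ 2 ≤ 0 := by
    by_contra! h0
    rw [h1] at h
    nlinarith [mul_pos hG h0]
  have h0 : pd 0 z p = 0 := pow_eq_zero_iff two_ne_zero |>.1 (le_antisymm h0 (sq_nonneg _))
  fin_cases i
  exacts [h0, h1]

theorem hasDerivAt_pd (hU : IsOpen U) (hz : ContDiffOn ℝ 2 z U) (hp : p ∈ U) (k i : Fin 2) :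
    HasDerivAt (fun t => pd i z (update p k t)) (hess g z k i p
      + (christoffel g 0 k i p * pd 0 z p + christoffel g 1 k i p * pd 1 z p)) (p k) := by
  rw [← pd_pd_eq_hess]
  exact hasDerivAt_comp_update (differentiableAt_of_contDiffOn hU
    (contDiffOn_pd hU hz (m := 1) (by norm_num) i) one_ne_zero hp) k

theorem hasDerivAt_metric (hU : IsOpen U) (hg : IsRiemannianMetricOn g U) (hp : p ∈ U)
    (k i j : Fin 2) : HasDerivAt (fun t => g (update p k t) i j)
      ((g p j 0 * christoffel g 0 k i p + g p j 1 * christoffel g 1 k i p)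
      + (g p i 0 * christoffel g 0 k j p + g p i 1 * christoffel g 1 k j p)) (p k) := by
  rw [← pd_metric hU hg hp]
  exact hasDerivAt_comp_update
      (differentiableAt_of_contDiffOn hU (hg.contDiffOn i j) two_ne_zero hp) k

/-- The derivative of `|∇z|²` is `2 gⁱʲ ∇ₖᵢz ∂ⱼz`. -/
theorem pd_gradSq (hU : IsOpen U) (hg : IsRiemannianMetricOn g U) (hz : ContDiffOn ℝ 2 z U)
    (hp : p ∈ U) (k : Fin 2) : pd k (gradSq g z) p
      = 2 * (hess g z k 0 p * (g p 1 1 * pd 0 z p - g p 0 1 * pd 1 z p)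
        + hess g z k 1 p * (g p 0 0 * pd 1 z p - g p 0 1 * pd 0 z p))
        / (g p 0 0 * g p 1 1 - g p 0 1 ^ 2) := by
  have hd := (hg.det_pos hp).ne'
  rw [pd_congr hU (fun q hq => gradSq_eq hg hq) hp k]
  have hz' := hasDerivAt_pd (g := g) hU hz hp k
  have hm := hasDerivAt_metric hU hg hp k
  have hnum := (((hm 1 1).mul ((hz' 0).pow 2)).sub ((((hm 0 1).const_mul 2).mul (hz' 0)).mul
    (hz' 1))).add ((hm 0 0).mul ((hz' 1).pow 2))
  have hden := ((hm 0 0).mul (hm 1 1)).sub ((hm 0 1).pow 2)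
  have h := hnum.div hden (by simpa using hd)
  refine pd_eq_of_hasDerivAt ?_ (h.congr_deriv ?_)
  · refine DifferentiableAt.congr_of_eventuallyEq (differentiableAt_of_contDiffOn hU
      (contDiffOn_gradSq hU hg hz) one_ne_zero hp) ?_
    exact Filter.eventuallyEq_of_mem (hU.mem_nhds hp) fun q hq => (gradSq_eq hg hq).symm
  · simp only [Pi.mul_apply, Pi.sub_apply, Pi.pow_apply, Pi.add_apply, update_eq_self,
      hg.symm hp 1 0]
    rw [div_eq_div_iff (pow_ne_zero 2 hd) hd]
    norm_num
    ring

/-- A nonzero value of `|∇z|²` below `1` at a critical point forces the curvature to vanish. -/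
theorem gradSq_nonpos_of_pd_eq_zero {K : Plane → ℝ} (hU : IsOpen U)
    (hg : IsRiemannianMetricOn g U) (hz : IsDarbouxSolution g K U z) (hp : p ∈ U)
    (hK : K p ≠ 0) (h1 : gradSq g z p < 1) (hc : ∀ k, pd k (gradSq g z) p = 0) :
    gradSq g z p ≤ 0 := by
  have hd := hg.det_pos hp
  have hdet := hz.eqn p hp
  rw [det_hess hU hg hz.contDiffOn hp, Matrix.det_fin_two, hg.symm hp 1 0, ← sq] at hdet
  have hne : hess g z 0 0 p * hess g z 1 1 p - hess g z 0 1 p ^ 2 ≠ 0 := by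
    rw [hdet]
    exact mul_ne_zero (mul_ne_zero hK hd.ne') (by linarith)
  have hk : ∀ k, hess g z k 0 p * (g p 1 1 * pd 0 z p - g p 0 1 * pd 1 z p)
        + hess g z k 1 p * (g p 0 0 * pd 1 z p - g p 0 1 * pd 0 z p) = 0 := by
    intro k
    have := hc k
    rw [pd_gradSq hU hg hz.contDiffOn hp, div_eq_zero_iff, or_iff_left hd.ne'] at this
    linarith
  have e0 := hk 0
  have e1 := hk 1
  rw [hess_symm hU hg hz.contDiffOn hp 1 0] at e1
  -- Cramer's rule: the invertible Hessian annihilates the vector `|g| ∇z`, whose components are the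
  -- left sides of `a0` and `a1`.
  have a0 : g p 1 1 * pd 0 z p - g p 0 1 * pd 1 z p = 0 := by
    refine (mul_eq_zero.1 ?_).resolve_left hne
    linear_combination hess g z 1 1 p * e0 - hess g z 0 1 p * e1
  have a1 : g p 0 0 * pd 1 z p - g p 0 1 * pd 0 z p = 0 := by
    refine (mul_eq_zero.1 ?_).resolve_left hne
    linear_combination hess g z 0 0 p * e1 - hess g z 0 1 p * e0
  rw [gradSq_eq hg hp]
  refine le_of_eq (div_eq_zero_iff.2 (Or.inl ?_))
  linear_combination pd 0 z p * a0 + pd 1 z p * a1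

/-- The gradient in the orthonormal frame obtained from `∂₂, ∂₁` by Gram-Schmidt, scaled by
`|∂₂|` and written as a complex number. -/
noncomputable def frameGradient (g : Plane → Matrix (Fin 2) (Fin 2) ℝ) (z : Plane → ℝ)
    (p : Plane) : ℂ :=
  ⟨pd 1 z p, (g p 1 1 * pd 0 z p - g p 0 1 * pd 1 z p) / areaDensity g p⟩

/-- The logarithmic derivative of `frameGradient` for a parallel gradient. -/
noncomputable def frameRate (g : Plane → Matrix (Fin 2) (Fin 2) ℝ) (k : Fin 2) (p : Plane) : ℂ :=
  ⟨christoffel g 1 k 1 p + christoffel g 0 k 1 p * g p 0 1 / g p 1 1, -connectionForm g k p⟩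

theorem pd_eq_zero_of_frameGradient (hg : IsRiemannianMetricOn g U) (hp : p ∈ U)
    (h : frameGradient g z p = 0) (i : Fin 2) : pd i z p = 0 := by
  have h1 : pd 1 z p = 0 := congrArg Complex.re h
  have h0 : (g p 1 1 * pd 0 z p - g p 0 1 * pd 1 z p) / areaDensity g p = 0 :=
    congrArg Complex.im h
  rw [div_eq_zero_iff, or_iff_left (areaDensity_pos hg hp).ne', h1, mul_zero, sub_zero,
    mul_eq_zero, or_iff_right (hg.diag_pos hp 1).ne'] at h0
  fin_cases i
  exacts [h0, h1]

theorem continuousOn_frameRate (hU : IsOpen U) (hg : IsRiemannianMetricOn g U) (k : Fin 2) :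
    ContinuousOn (frameRate g k) U := by
  have h : frameRate g k = fun p => (((christoffel g 1 k 1 p
      + christoffel g 0 k 1 p * g p 0 1 / g p 1 1 : ℝ) : ℂ)
      + ((-connectionForm g k p : ℝ) : ℂ) * Complex.I) := by
    funext p
    apply Complex.ext <;> simp [frameRate]
  rw [h]
  refine (Complex.continuous_ofReal.comp_continuousOn ?_).add
    ((Complex.continuous_ofReal.comp_continuousOn ?_).mul continuousOn_const)
  · exact (contDiffOn_christoffel hU hg 1 k 1).continuousOn.add
      (((contDiffOn_christoffel hU hg 0 k 1).continuousOn.mul (hg.contDiffOn 0 1).continuousOn).div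
        (hg.contDiffOn 1 1).continuousOn fun q hq => (hg.diag_pos hq 1).ne')
  · exact (contDiffOn_connectionForm hU hg k).continuousOn.neg

/-- The covariant derivative of `∇z` along `∂ₖ` is row `k` of the Hessian. When it vanishes, only
the frame moves: the real part of `frameRate` records the change of `log |∂₂|`, the imaginary part
the rotation. -/
theorem hasDerivAt_frameGradient (hU : IsOpen U) (hg : IsRiemannianMetricOn g U)
    (hz : ContDiffOn ℝ 2 z U) (hp : p ∈ U) {k : Fin 2} (hk : ∀ j, hess g z k j p = 0) :
    HasDerivAt (fun t => frameGradient g z (update p k t))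
      (frameRate g k p * frameGradient g z p) (p k) := by
  have hW := areaDensity_pos hg hp
  have hW2 := areaDensity_sq hg hp
  have hG := (hg.diag_pos hp 1).ne'
  have hz' := hasDerivAt_pd (g := g) hU hz hp k
  have hm := hasDerivAt_metric hU hg hp k
  have hWd := hasDerivAt_comp_update
    (differentiableAt_of_contDiffOn hU (contDiffOn_areaDensity hg) two_ne_zero hp) k
  rw [pd_areaDensity hU hg hp] at hWd
  have him := (((hm 1 1).mul (hz' 0)).sub ((hm 0 1).mul (hz' 1))).div hWd (by simpa using hW.ne')
  have h := (hz' 1).ofReal_comp.add (him.ofReal_comp.mul_const Complex.I)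
  refine (h.congr_of_eventuallyEq (Filter.Eventually.of_forall fun t =>
    Complex.mk_eq_add_mul_I _ _)).congr_deriv ?_
  simp only [Pi.mul_apply, Pi.sub_apply, update_eq_self, hg.symm hp 1 0, hk]
  apply Complex.ext
  · simp [frameRate, frameGradient, connectionForm, -Complex.ofReal_div, -Complex.ofReal_add,
      -Complex.ofReal_mul, -Complex.ofReal_sub, -Complex.ofReal_pow]
    field_simp
    ring
  · simp [frameRate, frameGradient, connectionForm, -Complex.ofReal_div, -Complex.ofReal_add,
      -Complex.ofReal_mul, -Complex.ofReal_sub, -Complex.ofReal_pow]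
    field_simp
    linear_combination (christoffel g 0 k 1 p * pd 1 z p) * hW2

end Gradient

/-! ### Parallel transport along coordinate segments. -/

section Transport

/-- Integrating factor: `u` times the exponential of minus the primitive of `c` has zero derivative.
-/
theorem eq_mul_exp_integral {u c : ℝ → ℂ} {a b : ℝ} (hab : a ≤ b) (hc : ContinuousOn c (Icc a b))
    (hu : ∀ t ∈ Icc a b, HasDerivAt u (c t * u t) t) :
    u b = u a * Complex.exp (∫ t in a..b, c t) := by
  -- The continuous extension of `c` to the line has a primitive with two-sided derivatives, also at
  -- the endpoints.
  set C : ℝ → ℂ := IccExtend hab ((Icc a b).domRestrict c) with hC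
  have hCc : Continuous C := (continuousOn_iff_continuous_domRestrict.1 hc).Icc_extend'
  have hCeq : ∀ t ∈ Icc a b, C t = c t := fun t ht => IccExtend_of_mem hab _ ht
  have hI : (∫ t in a..b, c t) = ∫ t in a..b, C t := by
    refine intervalIntegral.integral_congr fun t ht => ?_
    rw [uIcc_of_le hab] at ht
    exact (hCeq t ht).symm
  have hd : ∀ t ∈ Icc a b,
      HasDerivAt (fun s => u s * Complex.exp (-∫ r in a..s, C r)) 0 t := by
    intro t ht
    have h1 := ((hCc.integral_hasStrictDerivAt a t).hasDerivAt.fun_neg).cexp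
    refine ((hu t ht).mul h1).congr_deriv ?_
    rw [hCeq t ht]
    ring
  have h := constant_of_has_deriv_right_zero
    (fun t ht => (hd t ht).continuousAt.continuousWithinAt)
    (fun t ht => (hd t (Ico_subset_Icc_self ht)).hasDerivWithinAt) b (right_mem_Icc.2 hab)
  simp only [intervalIntegral.integral_same, neg_zero, Complex.exp_zero, mul_one] at h
  rw [hI, ← h, mul_assoc, ← Complex.exp_add, neg_add_cancel, Complex.exp_zero, mul_one]

variable {U : Set Plane} {g : Plane → Matrix (Fin 2) (Fin 2) ℝ} {z : Plane → ℝ}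

theorem frameGradient_transport (hU : IsOpen U) (hg : IsRiemannianMetricOn g U)
    (hz : ContDiffOn ℝ 2 z U) (p : Plane) (k : Fin 2) {a b : ℝ} (hab : a ≤ b)
    (hin : ∀ t ∈ Icc a b, update p k t ∈ U)
    (hk : ∀ t ∈ Icc a b, ∀ j, hess g z k j (update p k t) = 0) :
    frameGradient g z (update p k b) = frameGradient g z (update p k a)
      * Complex.exp (∫ t in a..b, frameRate g k (update p k t)) := by
  refine eq_mul_exp_integral (u := fun t => frameGradient g z (update p k t))
    (c := fun t => frameRate g k (update p k t)) hab ?_ fun t ht => ?_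
  · exact (continuousOn_frameRate hU hg k).comp
      (show Continuous (update p k) from continuous_const.update k continuous_id).continuousOn hin
  · have h := hasDerivAt_frameGradient hU hg hz (hin t ht) (hk t ht)
    simpa using h

end Transport

/-! ### Green's theorem and holonomy around a rectangle. -/

section Holonomy

variable {U : Set Plane} {g : Plane → Matrix (Fin 2) (Fin 2) ℝ} {z : Plane → ℝ}

theorem update_zero_vec (x y t : ℝ) : update (![x, y] : Plane) 0 t = ![t, y] := by
  ext i; fin_cases i <;> simp

theorem update_one_vec (x y t : ℝ) : update (![x, y] : Plane) 1 t = ![x, t] := by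
  ext i; fin_cases i <;> simp

theorem hasFDerivAt_comp_vec {f : Plane → ℝ} {q : ℝ × ℝ}
    (hf : DifferentiableAt ℝ f ![q.1, q.2]) :
    HasFDerivAt (fun r : ℝ × ℝ => f ![r.1, r.2]) ((fderiv ℝ f ![q.1, q.2]).comp
      ((ContinuousLinearEquiv.finTwoArrow ℝ ℝ).symm : ℝ × ℝ →L[ℝ] Plane)) q :=
  HasFDerivAt.comp q (f := fun r : ℝ × ℝ => (![r.1, r.2] : Plane)) hf.hasFDerivAt
    ((ContinuousLinearEquiv.finTwoArrow ℝ ℝ).symm : ℝ × ℝ →L[ℝ] Plane).hasFDerivAt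

theorem continuous_vec : Continuous fun r : ℝ × ℝ => (![r.1, r.2] : Plane) :=
  ((ContinuousLinearEquiv.finTwoArrow ℝ ℝ).symm : ℝ × ℝ →L[ℝ] Plane).continuous

/-- Green's theorem, as the divergence theorem for the field `(b, -a)`. -/
theorem integral_pd_sub_pd {a b : Plane → ℝ} (hU : IsOpen U) (ha : ContDiffOn ℝ 1 a U)
    (hb : ContDiffOn ℝ 1 b U) {x₀ x₁ y₀ y₁ : ℝ} (hx : x₀ ≤ x₁) (hy : y₀ ≤ y₁)
    (hin : ∀ q ∈ Icc (x₀, y₀) (x₁, y₁), ![q.1, q.2] ∈ U) :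
    ∫ q in Icc (x₀, y₀) (x₁, y₁), (pd 0 b ![q.1, q.2] - pd 1 a ![q.1, q.2])
      = (∫ x in x₀..x₁, a ![x, y₀]) + (∫ y in y₀..y₁, b ![x₁, y])
        - ((∫ y in y₀..y₁, b ![x₀, y]) + ∫ x in x₀..x₁, a ![x, y₁]) := by
  have hda : ∀ q ∈ Icc (x₀, y₀) (x₁, y₁), HasFDerivAt (fun r : ℝ × ℝ => -a ![r.1, r.2]) _ q :=
    fun q hq => (hasFDerivAt_comp_vec
      (differentiableAt_of_contDiffOn hU ha one_ne_zero (hin q hq))).neg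
  have hdb : ∀ q ∈ Icc (x₀, y₀) (x₁, y₁), HasFDerivAt (fun r : ℝ × ℝ => b ![r.1, r.2]) _ q :=
    fun q hq => hasFDerivAt_comp_vec
      (differentiableAt_of_contDiffOn hU hb one_ne_zero (hin q hq))
  have hsub : ∀ q : ℝ × ℝ, q ∈ Ioo x₀ x₁ ×ˢ Ioo y₀ y₁ \ (∅ : Set (ℝ × ℝ)) →
      q ∈ Icc (x₀, y₀) (x₁, y₁) := by
    rintro q ⟨⟨h1, h2⟩, -⟩
    exact ⟨⟨h1.1.le, h2.1.le⟩, ⟨h1.2.le, h2.2.le⟩⟩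
  have e0 : ((ContinuousLinearEquiv.finTwoArrow ℝ ℝ).symm (1, 0) : Plane) = Pi.single 0 1 := by
    ext i; fin_cases i <;> simp
  have e1 : ((ContinuousLinearEquiv.finTwoArrow ℝ ℝ).symm (0, 1) : Plane) = Pi.single 1 1 := by
    ext i; fin_cases i <;> simp
  have hfun : ∀ q : ℝ × ℝ, ((fderiv ℝ b ![q.1, q.2]).comp
      ((ContinuousLinearEquiv.finTwoArrow ℝ ℝ).symm : ℝ × ℝ →L[ℝ] Plane)) (1, 0)
      + (-((fderiv ℝ a ![q.1, q.2]).comp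
      ((ContinuousLinearEquiv.finTwoArrow ℝ ℝ).symm : ℝ × ℝ →L[ℝ] Plane))) (0, 1)
      = pd 0 b ![q.1, q.2] - pd 1 a ![q.1, q.2] := by
    intro q
    simp only [ContinuousLinearMap.comp_apply, neg_apply,
      ContinuousLinearEquiv.coe_coe, e0, e1, pd, sub_eq_add_neg]
  have h := integral_divergence_prod_Icc_of_hasFDerivAt_off_countable_of_le
    (fun r : ℝ × ℝ => b ![r.1, r.2]) (fun r : ℝ × ℝ => -a ![r.1, r.2]) _ _
    (x₀, y₀) (x₁, y₁) ⟨hx, hy⟩ ∅ countable_empty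
    (fun q hq => (hdb q hq).continuousAt.continuousWithinAt)
    (fun q hq => (hda q hq).continuousAt.continuousWithinAt)
    (fun q hq => hdb q (hsub q hq)) (fun q hq => hda q (hsub q hq)) ?_
  · simp only [hfun, intervalIntegral.integral_neg] at h
    rw [h]
    ring
  · simp only [hfun]
    refine ContinuousOn.integrableOn_compact isCompact_Icc ?_
    exact ((contDiffOn_pd hU hb (m := 0) (by norm_num) 0).continuousOn.comp
      continuous_vec.continuousOn hin).sub
      ((contDiffOn_pd hU ha (m := 0) (by norm_num) 1).continuousOn.comp
      continuous_vec.continuousOn hin)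

/-- The boundary is a null set, so positivity on the open rectangle suffices; the curvature does
vanish on the boundary in the application. -/
theorem setIntegral_Icc_pos {f : ℝ × ℝ → ℝ} {x₀ x₁ y₀ y₁ : ℝ} (hx : x₀ < x₁) (hy : y₀ < y₁)
    (hf : ContinuousOn f (Icc (x₀, y₀) (x₁, y₁)))
    (hpos : ∀ q ∈ Ioo x₀ x₁ ×ˢ Ioo y₀ y₁, 0 < f q) :
    0 < ∫ q in Icc (x₀, y₀) (x₁, y₁), f q := by
  have hae : (Ioo x₀ x₁ ×ˢ Ioo y₀ y₁ : Set (ℝ × ℝ)) =ᵐ[volume] Icc (x₀, y₀) (x₁, y₁) := by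
    rw [← Icc_prod_Icc, Measure.volume_eq_prod]
    exact Measure.set_prod_ae_eq Ioo_ae_eq_Icc Ioo_ae_eq_Icc
  have hint := hf.integrableOn_compact (μ := volume) isCompact_Icc
  rw [← setIntegral_congr_set hae]
  have hmeas : MeasurableSet (Ioo x₀ x₁ ×ˢ Ioo y₀ y₁ : Set (ℝ × ℝ)) :=
    measurableSet_Ioo.prod measurableSet_Ioo
  have hsub : (Ioo x₀ x₁ ×ˢ Ioo y₀ y₁ : Set (ℝ × ℝ)) ⊆ Icc (x₀, y₀) (x₁, y₁) := by
    rw [← Icc_prod_Icc]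
    exact prod_mono Ioo_subset_Icc_self Ioo_subset_Icc_self
  rw [setIntegral_pos_iff_support_of_nonneg_ae
    ((ae_restrict_iff' hmeas).2 (Filter.Eventually.of_forall fun q hq => (hpos q hq).le))
    (hint.mono_set hsub)]
  rw [inter_eq_right.2 fun q hq => mem_support.2 (hpos q hq).ne', Measure.volume_eq_prod, Measure.prod_prod,
    Real.volume_Ioo, Real.volume_Ioo]
  exact ENNReal.mul_pos (by simpa using hx) (by simpa using hy)

theorem setIntegral_Icc_ne_zero {f : ℝ × ℝ → ℝ} {x₀ x₁ y₀ y₁ : ℝ} (hx : x₀ < x₁) (hy : y₀ < y₁)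
    (hf : ContinuousOn f (Icc (x₀, y₀) (x₁, y₁)))
    (hsign : (∀ q ∈ Ioo x₀ x₁ ×ˢ Ioo y₀ y₁, 0 < f q) ∨ ∀ q ∈ Ioo x₀ x₁ ×ˢ Ioo y₀ y₁, f q < 0) :
    ∫ q in Icc (x₀, y₀) (x₁, y₁), f q ≠ 0 := by
  rcases hsign with h | h
  · exact (setIntegral_Icc_pos hx hy hf h).ne'
  · have := setIntegral_Icc_pos hx hy hf.neg fun q hq => neg_pos.2 (h q hq)
    simp only [Pi.neg_apply, integral_neg] at this
    linarith

theorem im_integral_frameRate (hU : IsOpen U) (hg : IsRiemannianMetricOn g U) (k : Fin 2)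
    {c : ℝ → Plane} (hc : Continuous c) {a b : ℝ} (hab : a ≤ b) (hin : ∀ t ∈ Icc a b, c t ∈ U) :
    (∫ t in a..b, frameRate g k (c t)).im = -∫ t in a..b, connectionForm g k (c t) := by
  have hi : IntervalIntegrable (fun t => frameRate g k (c t)) volume a b := by
    refine ContinuousOn.intervalIntegrable ?_
    rw [uIcc_of_le hab]
    exact (continuousOn_frameRate hU hg k).comp hc.continuousOn hin
  have h := Complex.imCLM.intervalIntegral_comp_comm hi
  simp only [Complex.imCLM_apply] at h
  rw [← h, ← intervalIntegral.integral_neg]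
  rfl

/-- A gradient that is parallel along the boundary of a small rectangle on which the curvature has
a strict sign vanishes on that boundary, because the holonomy is a nontrivial rotation. -/
theorem frameGradient_eq_zero_of_parallel (hU : IsOpen U) (hg : IsRiemannianMetricOn g U)
    (hz : ContDiffOn ℝ 2 z U) {x₀ x₁ y₀ y₁ : ℝ} (hx : x₀ < x₁) (hy : y₀ < y₁)
    (hin : ∀ q ∈ Icc (x₀, y₀) (x₁, y₁), ![q.1, q.2] ∈ U)
    (hK : (∀ q ∈ Ioo x₀ x₁ ×ˢ Ioo y₀ y₁, 0 < gaussCurvature g ![q.1, q.2]) ∨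
      ∀ q ∈ Ioo x₀ x₁ ×ˢ Ioo y₀ y₁, gaussCurvature g ![q.1, q.2] < 0)
    (hhor : ∀ x ∈ Icc x₀ x₁, ∀ j, hess g z 0 j ![x, y₀] = 0 ∧ hess g z 0 j ![x, y₁] = 0)
    (hver : ∀ y ∈ Icc y₀ y₁, ∀ j, hess g z 1 j ![x₀, y] = 0 ∧ hess g z 1 j ![x₁, y] = 0)
    {C : ℝ} (hC : ∀ k, ∀ q ∈ Icc (x₀, y₀) (x₁, y₁), |connectionForm g k ![q.1, q.2]| ≤ C)
    (hsmall : 2 * (C * (x₁ - x₀)) + 2 * (C * (y₁ - y₀)) < 2 * Real.pi) :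
    (∀ x ∈ Icc x₀ x₁, frameGradient g z ![x, y₀] = 0 ∧ frameGradient g z ![x, y₁] = 0) ∧
    ∀ y ∈ Icc y₀ y₁, frameGradient g z ![x₀, y] = 0 ∧ frameGradient g z ![x₁, y] = 0 := by
  have hx0 := left_mem_Icc.2 hx.le
  have hx1 := right_mem_Icc.2 hx.le
  have hy0 := left_mem_Icc.2 hy.le
  have hy1 := right_mem_Icc.2 hy.le
  have hin' : ∀ x ∈ Icc x₀ x₁, ∀ y ∈ Icc y₀ y₁, ![x, y] ∈ U :=
    fun x hx y hy => hin (x, y) ⟨⟨hx.1, hy.1⟩, ⟨hx.2, hy.2⟩⟩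
  have hC' : ∀ k, ∀ x ∈ Icc x₀ x₁, ∀ y ∈ Icc y₀ y₁, |connectionForm g k ![x, y]| ≤ C :=
    fun k x hx y hy => hC k (x, y) ⟨⟨hx.1, hy.1⟩, ⟨hx.2, hy.2⟩⟩
  have tHor : ∀ y ∈ Icc y₀ y₁, (∀ x ∈ Icc x₀ x₁, ∀ j, hess g z 0 j ![x, y] = 0) →
      ∀ x ∈ Icc x₀ x₁, frameGradient g z ![x, y] = frameGradient g z ![x₀, y]
        * Complex.exp (∫ t in x₀..x, frameRate g 0 ![t, y]) := by
    intro y hy h x hx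
    have := frameGradient_transport hU hg hz ![x₀, y] 0 hx.1 (fun t ht => by
      rw [update_zero_vec]; exact hin' t ⟨ht.1, ht.2.trans hx.2⟩ y hy) (fun t ht j => by
      rw [update_zero_vec]; exact h t ⟨ht.1, ht.2.trans hx.2⟩ j)
    simpa only [update_zero_vec] using this
  have tVer : ∀ x ∈ Icc x₀ x₁, (∀ y ∈ Icc y₀ y₁, ∀ j, hess g z 1 j ![x, y] = 0) →
      ∀ y ∈ Icc y₀ y₁, frameGradient g z ![x, y] = frameGradient g z ![x, y₀]
        * Complex.exp (∫ t in y₀..y, frameRate g 1 ![x, t]) := by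
    intro x hx h y hy
    have := frameGradient_transport hU hg hz ![x, y₀] 1 hy.1 (fun t ht => by
      rw [update_one_vec]; exact hin' x hx t ⟨ht.1, ht.2.trans hy.2⟩) (fun t ht j => by
      rw [update_one_vec]; exact h t ⟨ht.1, ht.2.trans hy.2⟩ j)
    simpa only [update_one_vec] using this
  have tB := tHor y₀ hy0 fun x hx j => (hhor x hx j).1
  have tT := tHor y₁ hy1 fun x hx j => (hhor x hx j).2
  have tL := tVer x₀ hx0 fun y hy j => (hver y hy j).1
  have tR := tVer x₁ hx1 fun y hy j => (hver y hy j).2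
  have hcorner : frameGradient g z ![x₀, y₀] = 0 := by
    by_contra hne
    have hcirc := integral_pd_sub_pd hU (contDiffOn_connectionForm hU hg 0)
      (contDiffOn_connectionForm hU hg 1) hx.le hy.le hin
    have hne0 : ∫ q in Icc (x₀, y₀) (x₁, y₁), (pd 0 (connectionForm g 1) ![q.1, q.2]
        - pd 1 (connectionForm g 0) ![q.1, q.2]) ≠ 0 := by
      refine setIntegral_Icc_ne_zero hx hy ?_ ?_
      · exact ((contDiffOn_pd hU (contDiffOn_connectionForm hU hg 1) (m := 0)
          (by norm_num) 0).continuousOn.comp continuous_vec.continuousOn hin).sub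
          ((contDiffOn_pd hU (contDiffOn_connectionForm hU hg 0) (m := 0)
          (by norm_num) 1).continuousOn.comp continuous_vec.continuousOn hin)
      · have hU' : ∀ q ∈ Ioo x₀ x₁ ×ˢ Ioo y₀ y₁, ![q.1, q.2] ∈ U := fun q hq =>
          hin' _ (Ioo_subset_Icc_self hq.1) _ (Ioo_subset_Icc_self hq.2)
        refine hK.imp (fun h q hq => ?_) (fun h q hq => ?_) <;>
          rw [pd_connectionForm_sub hU hg (hU' q hq)]
        · exact mul_pos (h q hq) (areaDensity_pos hg (hU' q hq))
        · exact mul_neg_of_neg_of_pos (h q hq) (areaDensity_pos hg (hU' q hq))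
    rw [hcirc] at hne0
    -- Transport to the opposite corner by bottom then right agrees with transport by left then top.
    -- Cancelling the nonzero initial value leaves the exponents equal modulo `2πi`.
    have hexp := tR y₁ hy1
    rw [tB x₁ hx1, tT x₁ hx1, tL y₁ hy1, mul_assoc, mul_assoc, ← Complex.exp_add,
      ← Complex.exp_add] at hexp
    obtain ⟨n, hn⟩ := Complex.exp_eq_exp_iff_exists_int.1 (mul_left_cancel₀ hne hexp)
    have him := congrArg Complex.im hn
    have cH : ∀ y : ℝ, Continuous fun t : ℝ => (![t, y] : Plane) := fun y =>
      continuous_vec.comp (continuous_id.prodMk continuous_const)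
    have cV : ∀ x : ℝ, Continuous fun t : ℝ => (![x, t] : Plane) := fun x =>
      continuous_vec.comp (continuous_const.prodMk continuous_id)
    rw [Complex.add_im, Complex.add_im, Complex.add_im,
      im_integral_frameRate hU hg 0 (cH y₀) hx.le fun t ht => hin' t ht _ hy0,
      im_integral_frameRate hU hg 0 (cH y₁) hx.le fun t ht => hin' t ht _ hy1,
      im_integral_frameRate hU hg 1 (cV x₀) hy.le fun t ht => hin' _ hx0 t ht,
      im_integral_frameRate hU hg 1 (cV x₁) hy.le fun t ht => hin' _ hx1 t ht] at him
    have hni : ((n : ℂ) * (2 * Real.pi * Complex.I)).im = n * (2 * Real.pi) := by simp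
    rw [hni] at him
    have bH : ∀ y ∈ Icc y₀ y₁, |∫ x in x₀..x₁, connectionForm g 0 ![x, y]| ≤ C * (x₁ - x₀) := by
      intro y hy
      have := intervalIntegral.norm_integral_le_of_norm_le_const (a := x₀) (b := x₁) (C := C)
        (f := fun x => connectionForm g 0 ![x, y]) fun t ht => by
          rw [uIoc_of_le hx.le] at ht
          exact hC' 0 t (Ioc_subset_Icc_self ht) y hy
      rwa [Real.norm_eq_abs, abs_of_pos (sub_pos.2 hx)] at this
    have bV : ∀ x ∈ Icc x₀ x₁, |∫ y in y₀..y₁, connectionForm g 1 ![x, y]| ≤ C * (y₁ - y₀) := by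
      intro x hx
      have := intervalIntegral.norm_integral_le_of_norm_le_const (a := y₀) (b := y₁) (C := C)
        (f := fun y => connectionForm g 1 ![x, y]) fun t ht => by
          rw [uIoc_of_le hy.le] at ht
          exact hC' 1 x hx t (Ioc_subset_Icc_self ht)
      rwa [Real.norm_eq_abs, abs_of_pos (sub_pos.2 hy)] at this
    have b1 := abs_le.1 (bH y₀ hy0)
    have b2 := abs_le.1 (bH y₁ hy1)
    have b3 := abs_le.1 (bV x₀ hx0)
    have b4 := abs_le.1 (bV x₁ hx1)
    have hpi := Real.pi_pos
    -- The circulation is smaller than `2π` in absolute value by `hsmall`, so the integer is `0` and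
    -- the circulation vanishes, contrary to `hne0`.
    have hn1 : (n : ℝ) < 1 := by
      by_contra! h
      nlinarith
    have hn2 : (-1 : ℝ) < n := by
      by_contra! h
      nlinarith
    have hn0 : n = 0 := by
      have h1 : n < 1 := by exact_mod_cast hn1
      have h2 : -1 < n := by exact_mod_cast hn2
      omega
    rw [hn0] at him
    apply hne0
    push_cast at him
    linarith
  have hB : ∀ x ∈ Icc x₀ x₁, frameGradient g z ![x, y₀] = 0 := fun x hx => by
    rw [tB x hx, hcorner, zero_mul]
  have hL : ∀ y ∈ Icc y₀ y₁, frameGradient g z ![x₀, y] = 0 := fun y hy => by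
    rw [tL y hy, hcorner, zero_mul]
  exact ⟨fun x hx => ⟨hB x hx, by rw [tT x hx, hL y₁ hy1, zero_mul]⟩,
    fun y hy => ⟨hL y hy, by rw [tR y hy, hB x₁ hx1, zero_mul]⟩⟩

end Holonomy

/-! ### Maximum principle for the squared gradient. -/

section MaximumPrinciple

variable {U : Set Plane} {g : Plane → Matrix (Fin 2) (Fin 2) ℝ} {z K : Plane → ℝ}

theorem closedSquare_eq_closedBall (c : Plane) {w : ℝ} (hw : 0 ≤ w) :
    closedSquare c w = Metric.closedBall c (w / 2) := by
  ext p
  rw [Metric.mem_closedBall, dist_pi_le_iff (by positivity)]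
  simp only [closedSquare, mem_ofPred_eq, Real.dist_eq]

theorem openSquare_eq_ball (c : Plane) {w : ℝ} (hw : 0 < w) :
    openSquare c w = Metric.ball c (w / 2) := by
  ext p
  rw [Metric.mem_ball, dist_pi_lt_iff (by positivity)]
  simp only [openSquare, mem_ofPred_eq, Real.dist_eq]

/-- A solution whose gradient is shorter than `1` on a square and zero on its boundary cannot have
nonvanishing curvature inside. -/
theorem IsDarbouxSolution.false_of_pd_eq_zero (hU : IsOpen U) (hg : IsRiemannianMetricOn g U)
    (hz : IsDarbouxSolution g K U z) {c : Plane} {w : ℝ} (hw : 0 < w)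
    (hS : closedSquare c w ⊆ U) (hK : ∀ p ∈ openSquare c w, K p ≠ 0)
    (h1 : ∀ p ∈ closedSquare c w, gradSq g z p < 1)
    (hbd : ∀ p ∈ closedSquare c w \ openSquare c w, ∀ i, pd i z p = 0) : False := by
  have hcomp : IsCompact (closedSquare c w) := by
    rw [closedSquare_eq_closedBall c hw.le]; exact isCompact_closedBall _ _
  have hopen : IsOpen (openSquare c w) := by
    rw [openSquare_eq_ball c hw]; exact Metric.isOpen_ball
  have hoc : openSquare c w ⊆ closedSquare c w := fun p hp i => (hp i).le
  have hc : c ∈ openSquare c w := fun i => by simpa using hw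
  have hgrad := contDiffOn_gradSq hU hg hz.contDiffOn
  obtain ⟨m, hm, hmax⟩ := hcomp.exists_isMaxOn ⟨c, hoc hc⟩ (hgrad.continuousOn.mono hS)
  have hm0 : gradSq g z m ≤ 0 := by
    by_cases hmo : m ∈ openSquare c w
    · refine gradSq_nonpos_of_pd_eq_zero hU hg hz (hS hm) (hK m hmo) (h1 m hm) fun k => ?_
      have hloc : IsLocalMax (gradSq g z) m :=
        (hmax.on_subset hoc).isLocalMax (hopen.mem_nhds hmo)
      rw [pd, hloc.fderiv_eq_zero]
      rfl
    · simp [gradSq, hbd m ⟨hm, hmo⟩]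
  have hzero : ∀ p ∈ openSquare c w, ∀ i, pd i z p = 0 := fun p hp =>
    pd_eq_zero_of_gradSq_nonpos hg (hS (hoc hp)) ((hmax (hoc hp)).trans hm0)
  -- With first and second derivatives zero at the center, the equation there reads `0 = K |g|`.
  have hpp : ∀ i j, pd i (pd j z) c = 0 := by
    intro i j
    rw [pd_congr hopen (f' := fun _ => 0) (fun q hq => hzero q hq j) hc i]
    simp [pd]
  have hcU := hS (hoc hc)
  have heq := hz.eqn c hcU
  rw [det_hess hU hg hz.contDiffOn hcU] at heq
  simp only [hess, gradSq, hzero c hc, hpp] at heq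
  simp only [mul_zero, Finset.sum_const_zero, sub_zero, mul_one, ne_eq, OfNat.ofNat_ne_zero,
    not_false_eq_true, zero_pow] at heq
  exact mul_ne_zero (hK c hc) (hg.posDef c hcU).det_pos.ne' heq.symm

end MaximumPrinciple

/-! ### Location of the squares and sign of the curvature on them. -/

section Squares

variable {K : Plane → ℝ}

theorem innerWidth_pos {n : ℕ} (hn : 1 ≤ n) : 0 < innerWidth n := by
  have : (0 : ℝ) < n := by exact_mod_cast hn
  unfold innerWidth
  positivity

theorem innerWidth_le {n : ℕ} (hn : 1 ≤ n) : innerWidth n ≤ 1 / (n : ℝ) / 2 := by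
  have : (0 : ℝ) < n := by exact_mod_cast hn
  unfold innerWidth
  rw [div_div]
  apply one_div_le_one_div_of_le (by positivity)
  nlinarith

theorem closedSquare_center_subset_ball {n : ℕ} (hn : 1 ≤ n) {r : ℝ} (hr : 2 * (1 / (n : ℝ)) < r) :
    closedSquare (center n) (innerWidth n) ⊆ Metric.ball 0 r := by
  have hn0 : (0 : ℝ) < 1 / (n : ℝ) := by
    have : (0 : ℝ) < n := by exact_mod_cast hn
    positivity
  have hw := innerWidth_le hn
  intro p hp
  rw [Metric.mem_ball, dist_pi_lt_iff (by linarith)]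
  have h0 := abs_le.1 (hp 0)
  have h1 := abs_le.1 (hp 1)
  simp only [center, Matrix.cons_val_zero, Matrix.cons_val_one] at h0 h1
  intro i
  rw [Real.dist_eq, Pi.zero_apply, sub_zero, abs_lt]
  fin_cases i
  · change -r < p 0 ∧ p 0 < r
    constructor <;> linarith
  · change -r < p 1 ∧ p 1 < r
    constructor <;> linarith

/-- The factor `4n(n+1)` is `2 / innerWidth n`, so the rescaling carries `Xⁿ` to the square of width
`2`. -/
theorem abs_rescale {n : ℕ} (hn : 1 ≤ n) (p : Plane) (i : Fin 2) :
    |((4 * (n : ℝ) * ((n : ℝ) + 1)) • (p - center n) - (0 : Plane)) i|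
      = 2 / innerWidth n * |p i - center n i| := by
  have : (0 : ℝ) < n := by exact_mod_cast hn
  rw [sub_zero, Pi.smul_apply, smul_eq_mul, abs_mul, abs_of_pos (by positivity), Pi.sub_apply]
  congr 1
  unfold innerWidth
  field_simp
  norm_num

theorem rescale_mem_closedSquare {n : ℕ} (hn : 1 ≤ n) {p : Plane} :
    (4 * (n : ℝ) * ((n : ℝ) + 1)) • (p - center n) ∈ closedSquare 0 2
      ↔ p ∈ closedSquare (center n) (innerWidth n) := by
  have hw := innerWidth_pos hn
  refine forall_congr' fun i => ?_
  have := abs_rescale hn p i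
  rw [Pi.sub_apply] at this
  rw [this, div_mul_eq_mul_div, div_le_iff₀ hw]
  constructor <;> intro h <;> linarith

theorem rescale_mem_openSquare {n : ℕ} (hn : 1 ≤ n) {p : Plane} :
    (4 * (n : ℝ) * ((n : ℝ) + 1)) • (p - center n) ∈ openSquare 0 2
      ↔ p ∈ openSquare (center n) (innerWidth n) := by
  have hw := innerWidth_pos hn
  refine forall_congr' fun i => ?_
  have := abs_rescale hn p i
  rw [Pi.sub_apply] at this
  rw [this, div_mul_eq_mul_div, div_lt_iff₀ hw]
  constructor <;> intro h <;> linarith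

theorem IsCurvatureFunction.sign (hK : IsCurvatureFunction K) {n : ℕ} (hn : 1 ≤ n) :
    (∀ p ∈ openSquare (center n) (innerWidth n), 0 < K p) ∨
      ∀ p ∈ openSquare (center n) (innerWidth n), K p < 0 := by
  obtain ⟨φ, γ, hφ, hγ, -, hK⟩ := hK.eq_profile
  have hoc : ∀ p ∈ openSquare (center n) (innerWidth n),
      p ∈ closedSquare (center n) (innerWidth n) := fun p hp i => (hp i).le
  refine hφ.sign.imp (fun h p hp => ?_) (fun h p hp => ?_) <;> rw [hK n hn p (hoc p hp)]
  · exact mul_pos (hγ n hn) (h _ ((rescale_mem_openSquare hn).2 hp))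
  · exact mul_neg_of_pos_of_neg (hγ n hn) (h _ ((rescale_mem_openSquare hn).2 hp))

theorem IsCurvatureFunction.eq_zero_of_mem_boundary (hK : IsCurvatureFunction K) {n : ℕ}
    (hn : 1 ≤ n) {p : Plane} (hp : p ∈ closedSquare (center n) (innerWidth n))
    (hp' : p ∉ openSquare (center n) (innerWidth n)) : K p = 0 := by
  obtain ⟨φ, γ, hφ, -, -, hK⟩ := hK.eq_profile
  -- Only the order `0` case of flatness is needed: the profile itself vanishes on the boundary.
  have h := hφ.flat _ ⟨(rescale_mem_closedSquare hn).2 hp,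
    fun h => hp' ((rescale_mem_openSquare hn).1 h)⟩ 0
  have h' := congrArg (fun m => m 0) h
  simp only [iteratedFDerivWithin_zero_apply] at h'
  rw [hK n hn p hp, h']
  simp

end Squares

/-! ### Combination on a single small square. -/

/-- The singular Hessian on the boundary makes the gradient parallel there, holonomy kills it, and
the maximum principle gives the contradiction. The hypotheses `hCw` and `hosc` are the two smallness
conditions met by squares near the origin. -/
theorem IsDarbouxSolution.not_parallel_of_small {U : Set Plane}
    {g : Plane → Matrix (Fin 2) (Fin 2) ℝ} {z K : Plane → ℝ} (hU : IsOpen U)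
    (hg : IsRiemannianMetricOn g U) (hgK : ∀ p ∈ U, gaussCurvature g p = K p)
    (hz : IsDarbouxSolution g K U z) {c : Plane} {w C : ℝ} (hw : 0 < w)
    (hS : closedSquare c w ⊆ U)
    (hsign : (∀ p ∈ openSquare c w, 0 < K p) ∨ ∀ p ∈ openSquare c w, K p < 0)
    (hbd : ∀ p ∈ closedSquare c w, p ∉ openSquare c w → K p = 0)
    (hC : ∀ k, ∀ p ∈ closedSquare c w, |connectionForm g k p| ≤ C) (hCw : C * w < 1)
    (hosc : ∀ p ∈ closedSquare c w, |gradSq g z p - gradSq g z 0| < 1 / 2) :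
    ¬ ((∀ p ∈ verticalSides c w, hess g z 1 1 p = 0) ∧
      ∀ p ∈ horizontalSides c w, hess g z 0 0 p = 0) := by
  rintro ⟨hv, hh⟩
  have hmemc : ∀ q : ℝ × ℝ, (![q.1, q.2] : Plane) ∈ closedSquare c w ↔
      q ∈ Icc (c 0 - w / 2, c 1 - w / 2) (c 0 + w / 2, c 1 + w / 2) := by
    intro q
    simp only [closedSquare, mem_ofPred_eq, Fin.forall_fin_two, Matrix.cons_val_zero,
      Matrix.cons_val_one, abs_le, mem_Icc, Prod.le_def]
    constructor <;> rintro ⟨⟨h1, h2⟩, h3, h4⟩ <;> refine ⟨⟨?_, ?_⟩, ?_, ?_⟩ <;> linarith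
  have hmemo : ∀ q ∈ Ioo (c 0 - w / 2) (c 0 + w / 2) ×ˢ Ioo (c 1 - w / 2) (c 1 + w / 2),
      (![q.1, q.2] : Plane) ∈ openSquare c w := by
    rintro q ⟨⟨h1, h2⟩, h3, h4⟩
    simp only [openSquare, mem_ofPred_eq, Fin.forall_fin_two, Matrix.cons_val_zero,
      Matrix.cons_val_one, abs_lt]
    refine ⟨⟨?_, ?_⟩, ?_, ?_⟩ <;> linarith
  have hoc : openSquare c w ⊆ closedSquare c w := fun p hp i => (hp i).le
  have hvc : verticalSides c w ⊆ closedSquare c w := fun p hp =>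
    Fin.forall_fin_two.2 ⟨hp.1.le, hp.2⟩
  have hhc : horizontalSides c w ⊆ closedSquare c w := fun p hp =>
    Fin.forall_fin_two.2 ⟨hp.1, hp.2.le⟩
  have hvo : ∀ p ∈ verticalSides c w, p ∉ openSquare c w := fun p hp h => (h 0).ne hp.1
  have hho : ∀ p ∈ horizontalSides c w, p ∉ openSquare c w := fun p hp h => (h 1).ne hp.2
  have hdet : ∀ p ∈ closedSquare c w, p ∉ openSquare c w →
      hess g z 0 0 p * hess g z 1 1 p - hess g z 0 1 p ^ 2 = 0 := by
    intro p hp hp'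
    rw [← det_hess hU hg hz.contDiffOn (hS hp), hz.eqn p (hS hp), hbd p hp hp', zero_mul, zero_mul]
  have hvpar : ∀ p ∈ verticalSides c w, ∀ j, hess g z 1 j p = 0 := by
    intro p hp
    have h := hdet p (hvc hp) (hvo p hp)
    rw [hv p hp, mul_zero, zero_sub, neg_eq_zero] at h
    refine Fin.forall_fin_two.2 ⟨?_, hv p hp⟩
    rw [hess_symm hU hg hz.contDiffOn (hS (hvc hp))]
    exact pow_eq_zero_iff two_ne_zero |>.1 h
  have hhpar : ∀ p ∈ horizontalSides c w, ∀ j, hess g z 0 j p = 0 := by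
    intro p hp
    have h := hdet p (hhc hp) (hho p hp)
    rw [hh p hp, zero_mul, zero_sub, neg_eq_zero] at h
    exact Fin.forall_fin_two.2 ⟨hh p hp, pow_eq_zero_iff two_ne_zero |>.1 h⟩
  have hw2 : |w / 2| = w / 2 := abs_of_pos (by positivity)
  have hmemh : ∀ x ∈ Icc (c 0 - w / 2) (c 0 + w / 2),
      (![x, c 1 - w / 2] : Plane) ∈ horizontalSides c w ∧
      (![x, c 1 + w / 2] : Plane) ∈ horizontalSides c w := by
    intro x hx
    have : |x - c 0| ≤ w / 2 := abs_le.2 ⟨by linarith [hx.1], by linarith [hx.2]⟩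
    simp [horizontalSides, this, hw2]
  have hmemv : ∀ y ∈ Icc (c 1 - w / 2) (c 1 + w / 2),
      (![c 0 - w / 2, y] : Plane) ∈ verticalSides c w ∧
      (![c 0 + w / 2, y] : Plane) ∈ verticalSides c w := by
    intro y hy
    have : |y - c 1| ≤ w / 2 := abs_le.2 ⟨by linarith [hy.1], by linarith [hy.2]⟩
    simp [verticalSides, this, hw2]
  -- The holonomy bound over the four sides is `4 C w < 4 < 2π`.
  have hpi := Real.pi_gt_three
  obtain ⟨hH, hV⟩ := frameGradient_eq_zero_of_parallel hU hg hz.contDiffOn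
    (x₀ := c 0 - w / 2) (x₁ := c 0 + w / 2) (y₀ := c 1 - w / 2) (y₁ := c 1 + w / 2)
    (by linarith) (by linarith) (fun q hq => hS ((hmemc q).2 hq))
    (hsign.imp
      (fun h q hq => by rw [hgK _ (hS (hoc (hmemo q hq)))]; exact h _ (hmemo q hq))
      (fun h q hq => by rw [hgK _ (hS (hoc (hmemo q hq)))]; exact h _ (hmemo q hq)))
    (fun x hx j => ⟨hhpar _ (hmemh x hx).1 j, hhpar _ (hmemh x hx).2 j⟩)
    (fun y hy j => ⟨hvpar _ (hmemv y hy).1 j, hvpar _ (hmemv y hy).2 j⟩)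
    (fun k q hq => hC k _ ((hmemc q).2 hq)) (by linarith)
  have hgrad : ∀ p ∈ closedSquare c w \ openSquare c w, ∀ i, pd i z p = 0 := by
    rintro p ⟨hp, hp'⟩
    refine pd_eq_zero_of_frameGradient hg (hS hp) ?_
    have hpv : p = ![p 0, p 1] := by ext i; fin_cases i <;> rfl
    have h0 := abs_le.1 (hp 0)
    have h1 := abs_le.1 (hp 1)
    have hI0 : p 0 ∈ Icc (c 0 - w / 2) (c 0 + w / 2) := ⟨by linarith, by linarith⟩
    have hI1 : p 1 ∈ Icc (c 1 - w / 2) (c 1 + w / 2) := ⟨by linarith, by linarith⟩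
    have hex : ∃ i, w / 2 ≤ |p i - c i| := by
      simpa only [openSquare, mem_ofPred_eq, not_forall, not_lt] using hp'
    obtain ⟨i, hi⟩ := hex
    fin_cases i
    · rcases le_abs.1 hi with h | h
      · have : p 0 = c 0 + w / 2 := le_antisymm hI0.2 (by simp at h; linarith)
        rw [hpv, this]; exact (hV _ hI1).2
      · have : p 0 = c 0 - w / 2 := le_antisymm (by simp at h; linarith) hI0.1
        rw [hpv, this]; exact (hV _ hI1).1
    · rcases le_abs.1 hi with h | h
      · have : p 1 = c 1 + w / 2 := le_antisymm hI1.2 (by simp at h; linarith)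
        rw [hpv, this]; exact (hH _ hI0).2
      · have : p 1 = c 1 - w / 2 := le_antisymm (by simp at h; linarith) hI1.1
        rw [hpv, this]; exact (hH _ hI0).1
  refine hz.false_of_pd_eq_zero hU hg hw hS
    (fun p hp => hsign.elim (fun h => (h p hp).ne') fun h => (h p hp).ne) (fun p hp => ?_) hgrad
  -- At the midpoint of the left side the gradient is zero, so `hosc` gives `|∇z|² < 1/2` at the
  -- origin, hence `|∇z|² < 1` on the whole square.
  have hq := (hmemv (c 1) ⟨by linarith, by linarith⟩).1
  have hq0 : gradSq g z ![c 0 - w / 2, c 1] = 0 := by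
    simp [gradSq, hgrad _ ⟨hvc hq, hvo _ hq⟩]
  have h1 := abs_lt.1 (hosc _ (hvc hq))
  have h2 := abs_lt.1 (hosc p hp)
  rw [hq0] at h1
  linarith

end Darboux

theorem lemma2 (K : Darboux.Plane → ℝ) (hK : Darboux.IsCurvatureFunction K)
    (U : Set Darboux.Plane) (hU : IsOpen U) (h0 : (0 : Darboux.Plane) ∈ U)
    (g : Darboux.Plane → Matrix (Fin 2) (Fin 2) ℝ) (hg : Darboux.IsRiemannianMetricOn g U)
    (hgK : ∀ p ∈ U, Darboux.gaussCurvature g p = K p)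
    (z : Darboux.Plane → ℝ) (hz : Darboux.IsDarbouxSolution g K U z) :
    ∃ N : ℕ, 1 ≤ N ∧ ∀ n : ℕ, N ≤ n →
      Darboux.closedSquare (Darboux.center n) (Darboux.innerWidth n) ⊆ U ∧
      ¬ ((∀ p ∈ Darboux.verticalSides (Darboux.center n) (Darboux.innerWidth n),
            Darboux.hess g z 1 1 p = 0) ∧
          (∀ p ∈ Darboux.horizontalSides (Darboux.center n) (Darboux.innerWidth n),
            Darboux.hess g z 0 0 p = 0)) := by
  have hU0 := hU.mem_nhds h0
  -- The summand `1` makes the bound strict at the origin, so that it persists nearby by continuity.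
  set C : ℝ := |Darboux.connectionForm g 0 0| + |Darboux.connectionForm g 1 0| + 1 with hCdef
  have hC0 : 0 < C := by positivity
  have hω : ∀ k, ∀ᶠ p in 𝓝 (0 : Darboux.Plane), |Darboux.connectionForm g k p| < C := by
    intro k
    have hc : ContinuousAt (Darboux.connectionForm g k) 0 :=
      (Darboux.contDiffOn_connectionForm hU hg k).continuousOn.continuousAt hU0
    refine hc.abs.eventually_lt continuousAt_const ?_
    have h0 := abs_nonneg (Darboux.connectionForm g 0 0)
    have h1 := abs_nonneg (Darboux.connectionForm g 1 0)
    revert k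
    refine Fin.forall_fin_two.2 ⟨fun _ => ?_, fun _ => ?_⟩ <;> linarith
  have hosc : ∀ᶠ p in 𝓝 (0 : Darboux.Plane),
      |Darboux.gradSq g z p - Darboux.gradSq g z 0| < 1 / 2 := by
    have hc : ContinuousAt (Darboux.gradSq g z) 0 :=
      (Darboux.contDiffOn_gradSq hU hg hz.contDiffOn).continuousOn.continuousAt hU0
    exact Metric.continuousAt_iff'.1 hc (1 / 2) (by norm_num)
  obtain ⟨r, hr, hball⟩ := Metric.eventually_nhds_iff_ball.1
    ((Filter.eventually_all.2 hω).and (hosc.and hU0))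
  -- `1/n < r/2` puts the square inside the ball, and `1/n < 1/C` gives `C * innerWidth n < 1`.
  have hev := (tendsto_one_div_atTop_nhds_zero_nat (𝕜 := ℝ)).eventually_lt_const
    (show (0 : ℝ) < min (r / 2) (1 / C) by positivity)
  obtain ⟨N, hN⟩ := Filter.eventually_atTop.1 hev
  refine ⟨max N 1, le_max_right _ _, fun n hn => ?_⟩
  have hn1 : 1 ≤ n := (le_max_right _ _).trans hn
  have hlt := hN n ((le_max_left _ _).trans hn)
  have hlt1 := hlt.trans_le (min_le_left _ _)
  have hlt2 := hlt.trans_le (min_le_right _ _)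
  have hsub := Darboux.closedSquare_center_subset_ball hn1 (r := r) (by linarith)
  have hS : Darboux.closedSquare (Darboux.center n) (Darboux.innerWidth n) ⊆ U :=
    fun p hp => (hball p (hsub hp)).2.2
  refine ⟨hS, hz.not_parallel_of_small hU hg hgK (Darboux.innerWidth_pos hn1) hS (hK.sign hn1)
    (fun p hp hp' => hK.eq_zero_of_mem_boundary hn1 hp hp')
    (fun k p hp => ((hball p (hsub hp)).1 k).le) ?_ (fun p hp => (hball p (hsub hp)).2.1)⟩
  have hw := Darboux.innerWidth_le hn1
  have hwp := Darboux.innerWidth_pos hn1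
  have : Darboux.innerWidth n < 1 / C := by linarith
  rwa [lt_div_iff₀ hC0, mul_comm] at this
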